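/- Let $\mathbb{F}_q$ be a finite field with $q$ odd, $A=\mathbb{F}_q[T]$, $F=\mathbb{F}_q(T)$, let $F_\infty$ be the completion of $F$ for the absolute value with $|a/b|=q^{\deg a-\deg b}$, $\mathbb{C}_\infty$ the completion of an algebraic closure of $F_\infty$, and $\Omega=\mathbb{C}_\infty\setminus F_\infty$, on which $\mathrm{GL}_2(A)$ acts by linear fractional transformations. For a congruence subgroup $\Gamma\subseteq\mathrm{GL}_2(A)$ (one containing $\Gamma(\mathfrak{m})=\ker(\mathrm{GL}_2(A)\to\mathrm{GL}_2(A/\mathfrak{m}))$ for some $0\ne\mathfrak{m}\in A$), $w\in\mathbb{Z}_{\ge 0}$ and $m\in\mathbb{Z}/(q-1)\mathbb{Z}$, let $M_{w,m}(\Gamma)$ be the $\mathbb{C}_\infty$-vector space of rigid-analytic holomorphic functions $f\colon\Omega\to\mathbb{C}_\infty$ with $$f(\gamma z)=(\det\gamma)^{-m}(cz+d)^{w}f(z)\qquad\text{for all }\gamma=\begin{pmatrix}a&b\\c&d\end{pmatrix}\in\Gamma,$$ such that for every $g=\begin{pmatrix}a&b\\c&d\end{pmatrix}\in\mathrm{GL}_2(A)$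 the function $f|_g(z)=(\det g)^m(cz+d)^{-w}f(gz)$ is holomorphic at $\infty$. The latter means: if $0\ne\beta\in A$ and all matrices $\begin{pmatrix}1&x\\0&1\end{pmatrix}$ with $x\in \beta A$ lie in $g^{-1}\Gamma g$, then $f|_g(z)=\sum_{n\ge 0}a_n e_{\beta A}(z)^{-n}$ with some $a_n\in\mathbb{C}_\infty$, for all $z\in\Omega$ with $\inf_{\alpha\in F_\infty}|z-\alpha|$ sufficiently large, where $e_{\beta A}(z)=z\prod_{0\ne\lambda\in \beta A}(1-z/\lambda)$. Let $0\ne\mathfrak{n}\in A$, let $\Gamma_0(\mathfrak{n})$ be the group of matrices in $\mathrm{GL}_2(A)$ whose lower left entry is divisible by $\mathfrak{n}$, and $\Gamma_0^1(\mathfrak{n})=\Gamma_0(\mathfrak{n})\cap\mathrm{SL}_2(A)$. Then for every integer $k\ge 0$, as subspaces of the space of functions on $\Omega$, $$M_{2k,0}(\Gamma_0^1(\mathfrak{n}))=M_{2k,k}(\Gamma_0(\mathfrak{n}))\oplus M_{2k,k+\frac{q-1}{2}}(\Gamma_0(\mathfrak{n})).$$ Moreover, this is the isotypic decomposition under $\Gamma_0(\mathfrak{n})/\Gamma_0^1(\mathfrak{n})$: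 the determinant induces an isomorphism $\Gamma_0(\mathfrak{n})/\Gamma_0^1(\mathfrak{n})\cong\mathbb{F}_q^\times$; the rule $(f|_\gamma)(z)=(cz+d)^{-2k}f(\gamma z)$, $\gamma\in\Gamma_0(\mathfrak{n})$, defines a representation of this quotient on $M_{2k,0}(\Gamma_0^1(\mathfrak{n}))$; for every $m\in\mathbb{Z}/(q-1)\mathbb{Z}$ the isotypic component of the character $\det^{-m}$ is $M_{2k,m}(\Gamma_0(\mathfrak{n}))$; and this component is zero unless $m=k$ or $m=k+\frac{q-1}{2}$ in $\mathbb{Z}/(q-1)\mathbb{Z}$. -/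

import Mathlib

open Polynomial

noncomputable section

namespace DrinfeldForms

/-! ### The fields `F = 𝔽_q(T)`, `F_∞` and `ℂ_∞` -/

section Fields

variable (Fq : Type*) [Field Fq] [Fintype Fq]

open Classical in
/-- The absolute value on `F = 𝔽_q(T)` at the place `∞`: `|a / b| = q ^ (deg a - deg b)`,
normalised by `|T| = q`. -/
def absInfty : AbsoluteValue (RatFunc Fq) ℝ where
  toFun r := if r = 0 then 0 else (Fintype.card Fq : ℝ) ^ r.intDegree
  map_mul' x y := by
    by_cases hx : x = 0
    · simp [hx]
    by_cases hy : y = 0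
    · simp [hy]
    have hq : (Fintype.card Fq : ℝ) ≠ 0 := by simp
    simp [hx, hy, RatFunc.intDegree_mul hx hy, zpow_add₀ hq]
  nonneg' x := by split_ifs <;> positivity
  eq_zero' x := by
    have hq : (Fintype.card Fq : ℝ) ≠ 0 := by simp
    by_cases hx : x = 0 <;> simp [hx, zpow_ne_zero]
  add_le' x y := by
    have hq : (1 : ℝ) ≤ Fintype.card Fq := by exact_mod_cast Fintype.card_pos
    by_cases hx : x = 0
    · simp [hx]
    by_cases hy : y = 0
    · simp [hy]
    have h1 : 0 ≤ (Fintype.card Fq : ℝ) ^ x.intDegree := by positivity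
    have h2 : 0 ≤ (Fintype.card Fq : ℝ) ^ y.intDegree := by positivity
    by_cases hxy : x + y = 0
    · simp only [hxy, hx, hy, if_true, if_false]; linarith
    simp only [hxy, hx, hy, if_false]
    rcases le_max_iff.1 (RatFunc.intDegree_add_le hy hxy) with h | h
    · linarith [zpow_le_zpow_right₀ hq h]
    · linarith [zpow_le_zpow_right₀ hq h]

theorem absInfty_of_ne_zero {r : RatFunc Fq} (hr : r ≠ 0) :
    absInfty Fq r = (Fintype.card Fq : ℝ) ^ r.intDegree :=
  if_neg hr

theorem absInfty_add_le_max (x y : RatFunc Fq) :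
    absInfty Fq (x + y) ≤ max (absInfty Fq x) (absInfty Fq y) := by
  have hq : (1 : ℝ) ≤ Fintype.card Fq := by exact_mod_cast Fintype.card_pos
  by_cases hx : x = 0
  · simp [hx]
  by_cases hy : y = 0
  · simp [hy]
  by_cases hxy : x + y = 0
  · simp [hxy]
  rw [absInfty_of_ne_zero Fq hx, absInfty_of_ne_zero Fq hy, absInfty_of_ne_zero Fq hxy]
  rcases le_max_iff.1 (RatFunc.intDegree_add_le hy hxy) with h | h
  · exact (zpow_le_zpow_right₀ hq h).trans (le_max_left _ _)
  · exact (zpow_le_zpow_right₀ hq h).trans (le_max_right _ _)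

theorem absInfty_X : absInfty Fq RatFunc.X = Fintype.card Fq := by
  rw [absInfty_of_ne_zero Fq RatFunc.X_ne_zero]
  simp

/-- `F_∞`, the completion of `F = 𝔽_q(T)` at `∞`. -/
abbrev Finf := (absInfty Fq).Completion

instance : IsUltrametricDist (WithAbs (absInfty Fq)) :=
  IsUltrametricDist.isUltrametricDist_of_forall_norm_add_le_max_norm
    fun x y => absInfty_add_le_max Fq x.ofAbs y.ofAbs

instance : IsUltrametricDist (Finf Fq) :=
  IsUltrametricDist.of_normedAlgebra (WithAbs (absInfty Fq))

instance : NontriviallyNormedField (Finf Fq) where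
  non_trivial := by
    refine ⟨((WithAbs.toAbs (absInfty Fq) RatFunc.X : WithAbs (absInfty Fq)) : Finf Fq), ?_⟩
    rw [UniformSpace.Completion.norm_coe]
    change 1 < absInfty Fq RatFunc.X
    rw [absInfty_X]
    exact_mod_cast Fintype.one_lt_card

/-- An algebraic closure of `F_∞`. -/
abbrev FinfAlgCl := AlgebraicClosure (Finf Fq)

/-- The unique extension of the absolute value of `F_∞` to its algebraic closure. -/
instance : NormedField (FinfAlgCl Fq) := spectralNorm.normedField (Finf Fq) (FinfAlgCl Fq)

instance : NormedAlgebra (Finf Fq) (FinfAlgCl Fq) :=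
  spectralNorm.normedAlgebra (Finf Fq) (FinfAlgCl Fq)

/-- `ℂ_∞`, the completion of an algebraic closure of `F_∞`; it carries the absolute value
extending that of `F_∞`. -/
abbrev Cinf := UniformSpace.Completion (FinfAlgCl Fq)

/-- The embedding of `A = 𝔽_q[T]` into `F_∞`. -/
def ofPolyInf : Fq[X] →+* Finf Fq :=
  ((algebraMap (WithAbs (absInfty Fq)) (Finf Fq)).comp
    (WithAbs.equiv (absInfty Fq)).symm.toRingHom).comp (algebraMap Fq[X] (RatFunc Fq))

/-- The embedding of `A = 𝔽_q[T]` into `ℂ_∞`. -/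
def ofPoly : Fq[X] →+* Cinf Fq :=
  (algebraMap (Finf Fq) (Cinf Fq)).comp (ofPolyInf Fq)

end Fields

/-! ### The Drinfeld upper half-plane -/

section HalfPlane

variable (Fq : Type*) [Field Fq] [Fintype Fq]

/-- The Drinfeld upper half-plane `Ω = ℂ_∞ - F_∞`. -/
abbrev Omega := {z : Cinf Fq // z ∉ Set.range (algebraMap (Finf Fq) (Cinf Fq))}

variable {Fq}

/-- The imaginary part `inf_{α ∈ F_∞} |z - α|`. -/
def imag (z : Cinf Fq) : ℝ := ⨅ α : Finf Fq, ‖z - algebraMap (Finf Fq) (Cinf Fq) α‖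

/-- The group `GL₂(A)`. -/
abbrev GLA (Fq : Type*) [Field Fq] := GL (Fin 2) Fq[X]

/-- The factor `c z + d` for `γ = (a b; c d)`. -/
def denom (γ : GLA Fq) (z : Cinf Fq) : Cinf Fq :=
  ofPoly Fq (γ 1 0) * z + ofPoly Fq (γ 1 1)

/-- The determinant of `γ` as an element of `ℂ_∞`. -/
def detC (γ : GLA Fq) : Cinf Fq := ofPoly Fq (γ.det : Fq[X])

theorem ofPolyInf_injective : Function.Injective (ofPolyInf Fq) := by
  unfold ofPolyInf
  rw [RingHom.coe_comp]
  exact (RingHom.injective _).comp (RatFunc.algebraMap_injective Fq)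

theorem moebius_mem (γ : GLA Fq) (z : Omega Fq) :
    (ofPoly Fq (γ 0 0) * (z : Cinf Fq) + ofPoly Fq (γ 0 1)) / denom γ z ∉
      Set.range (algebraMap (Finf Fq) (Cinf Fq)) := by
  have key : ∀ u v : Finf Fq, algebraMap (Finf Fq) (Cinf Fq) u * (z : Cinf Fq) +
      algebraMap (Finf Fq) (Cinf Fq) v = 0 → u = 0 ∧ v = 0 := by
    intro u v h
    by_cases hu : u = 0
    · subst hu
      simpa using h
    · refine absurd ⟨-v / u, ?_⟩ z.2
      have hu' : algebraMap (Finf Fq) (Cinf Fq) u ≠ 0 := by simpa using hu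
      rw [map_div₀, map_neg, div_eq_iff hu']
      linear_combination -h
  have hdet : γ 0 0 * γ 1 1 - γ 0 1 * γ 1 0 ≠ 0 := by
    have := γ.det.ne_zero
    rwa [Matrix.GeneralLinearGroup.val_det_apply, Matrix.det_fin_two] at this
  have hdet' : ofPolyInf Fq (γ 0 0) * ofPolyInf Fq (γ 1 1) -
      ofPolyInf Fq (γ 0 1) * ofPolyInf Fq (γ 1 0) ≠ 0 := by
    rw [← map_mul, ← map_mul, ← map_sub]
    exact (map_ne_zero_iff _ ofPolyInf_injective).2 hdet
  have hden : denom γ z ≠ 0 := by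
    intro h
    obtain ⟨h1, h2⟩ := key _ _ h
    rw [h1, h2] at hdet'
    simp at hdet'
  rintro ⟨x, hx⟩
  rw [eq_div_iff hden] at hx
  obtain ⟨h1, h2⟩ := key (ofPolyInf Fq (γ 0 0) - x * ofPolyInf Fq (γ 1 0))
    (ofPolyInf Fq (γ 0 1) - x * ofPolyInf Fq (γ 1 1)) (by
      simp only [map_sub, map_mul]
      simp only [denom, ofPoly, RingHom.comp_apply] at hx
      linear_combination -hx)
  apply hdet'
  linear_combination ofPolyInf Fq (γ 1 1) * h1 - ofPolyInf Fq (γ 1 0) * h2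

/-- The action of `GL₂(A)` on `Ω` by linear fractional transformations. -/
def moebius (γ : GLA Fq) (z : Omega Fq) : Omega Fq :=
  ⟨(ofPoly Fq (γ 0 0) * (z : Cinf Fq) + ofPoly Fq (γ 0 1)) / denom γ z, moebius_mem γ z⟩

variable (Fq) in
/-- The standard admissible covering of `Ω` by the affinoids
`Ω_n = {z : |z| ≤ q ^ n, |z - α| ≥ q ^ (-n) for all α ∈ F_∞}`. -/
def affinoid (n : ℕ) : Set (Omega Fq) :=
  {z | ‖(z : Cinf Fq)‖ ≤ (Fintype.card Fq : ℝ) ^ n ∧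
    ((Fintype.card Fq : ℝ) ^ n)⁻¹ ≤ imag (z : Cinf Fq)}

/-- Rigid-analytic holomorphy on `Ω`: on every affinoid `Ω_n` the function is a uniform limit of
rational functions without poles on `Ω_n`. -/
def IsHolomorphic (f : Omega Fq → Cinf Fq) : Prop :=
  ∀ n : ℕ, ∀ ε : ℝ, 0 < ε → ∃ p r : (Cinf Fq)[X],
    (∀ z ∈ affinoid Fq n, r.eval (z : Cinf Fq) ≠ 0) ∧
    ∀ z ∈ affinoid Fq n, ‖f z - p.eval (z : Cinf Fq) / r.eval (z : Cinf Fq)‖ < ε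

/-- The exponential function `e_Λ(x) = x ∏_{0 ≠ λ ∈ Λ} (1 - x / λ)`. -/
def expLattice (Λ : Set (Cinf Fq)) (x : Cinf Fq) : Cinf Fq :=
  x * ∏' l : {l : Cinf Fq // l ∈ Λ ∧ l ≠ 0}, (1 - x / (l : Cinf Fq))

/-- The rank one lattice `bA ⊆ ℂ_∞`. -/
def principalLattice (b : Fq[X]) : Set (Cinf Fq) :=
  Set.range fun a : Fq[X] => ofPoly Fq (b * a)

end HalfPlane

/-! ### Congruence subgroups -/

section Groups

variable {Fq : Type*} [Field Fq]

/-- The principal congruence subgroup `Γ(𝔫)`: the kernel of reduction modulo `𝔫`. -/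
def GammaFull (n : Fq[X]) : Subgroup (GLA Fq) :=
  (Matrix.GeneralLinearGroup.map (n := Fin 2)
    (Ideal.Quotient.mk (Ideal.span {n}))).ker

/-- `Γ` is a congruence subgroup: it contains `Γ(𝔫)` for some `𝔫 ≠ 0`. -/
def IsCongruence (Γ : Subgroup (GLA Fq)) : Prop :=
  ∃ n : Fq[X], n ≠ 0 ∧ GammaFull n ≤ Γ

/-- The Hecke congruence group `Γ₀(𝔫)`. -/
def Gamma0 (n : Fq[X]) : Subgroup (GLA Fq) where
  carrier := {γ | n ∣ γ 1 0}
  one_mem' := by simp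
  mul_mem' {γ δ} hγ hδ := by
    simp only [Set.mem_ofPred_eq, Matrix.GeneralLinearGroup.coe_mul, Matrix.mul_apply,
      Fin.sum_univ_two] at *
    exact dvd_add (hγ.mul_right _) (hδ.mul_left _)
  inv_mem' {γ} hγ := by
    simp only [Set.mem_ofPred_eq] at *
    rw [Matrix.coe_units_inv, Matrix.inv_def, Matrix.adjugate_fin_two]
    simpa using hγ

/-- `Γ₀¹(𝔫) = Γ₀(𝔫) ∩ SL₂(A)`. -/
def Gamma01 (n : Fq[X]) : Subgroup (GLA Fq) :=
  Gamma0 n ⊓ (Matrix.GeneralLinearGroup.det (n := Fin 2) (R := Fq[X])).ker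

theorem gammaFull_le_gamma0 (n : Fq[X]) : GammaFull n ≤ Gamma0 n := by
  intro γ hγ
  have h := congrArg (fun g : GL (Fin 2) (Fq[X] ⧸ Ideal.span {n}) => g 1 0)
    (MonoidHom.mem_ker.1 hγ)
  have h' : Ideal.Quotient.mk (Ideal.span {n}) (γ 1 0) = 0 := by simpa using h
  exact Ideal.mem_span_singleton.1 (Ideal.Quotient.eq_zero_iff_mem.1 h')

theorem gamma0_isCongruence {n : Fq[X]} (hn : n ≠ 0) : IsCongruence (Gamma0 n) :=
  ⟨n, hn, gammaFull_le_gamma0 n⟩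

theorem gamma01_isCongruence {n : Fq[X]} (hn : n ≠ 0) : IsCongruence (Gamma01 n) := by
  refine ⟨n * X, mul_ne_zero hn X_ne_zero, fun γ hγ => ⟨?_, ?_⟩⟩
  · exact (dvd_mul_right n X).trans (gammaFull_le_gamma0 (n * X) hγ)
  · have h := congrArg (fun g : GL (Fin 2) (Fq[X] ⧸ Ideal.span {n * X}) => (g.det : Fq[X] ⧸ Ideal.span {n * X}))
      (MonoidHom.mem_ker.1 hγ)
    have h' : Ideal.Quotient.mk (Ideal.span {n * X}) ((γ.det : Fq[X]) - 1) = 0 := by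
      simpa [sub_eq_zero, RingHom.map_det] using h
    have h2 : X ∣ (γ.det : Fq[X]) - 1 := (dvd_mul_left X n).trans
      (Ideal.mem_span_singleton.1 (Ideal.Quotient.eq_zero_iff_mem.1 h'))
    obtain ⟨c, -, hc⟩ := Polynomial.isUnit_iff.1 γ.det.isUnit
    rw [X_dvd_iff, ← hc] at h2
    have hc1 : c = 1 := by simpa [sub_eq_zero] using h2
    refine MonoidHom.mem_ker.2 (Units.ext ?_)
    rw [← hc, hc1]
    simp

/-- The conjugate `g⁻¹ Γ g`. -/
def conjGroup (Γ : Subgroup (GLA Fq)) (g : GLA Fq) : Subgroup (GLA Fq) :=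
  Γ.comap (MulAut.conj g).toMonoidHom

/-- `Γ` contains the group `U_b` of matrices `(1 x; 0 1)` with `x ∈ bA`. -/
def ContainsUnipotent (Γ : Subgroup (GLA Fq)) (b : Fq[X]) : Prop :=
  ∀ a : Fq[X], Matrix.GeneralLinearGroup.upperRightHom (b * a) ∈ Γ

/-- Every conjugate of a congruence subgroup contains some `U_b` with `b ≠ 0`, so that the
quantification over such `b` in the condition at the cusps is never void. -/
theorem IsCongruence.exists_containsUnipotent {Γ : Subgroup (GLA Fq)} (hΓ : IsCongruence Γ)
    (g : GLA Fq) : ∃ b : Fq[X], b ≠ 0 ∧ ContainsUnipotent (conjGroup Γ g) b := by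
  obtain ⟨n, hn, hle⟩ := hΓ
  refine ⟨n, hn, fun a => hle ?_⟩
  have : (GammaFull n).Normal := MonoidHom.normal_ker _
  refine this.conj_mem _ (MonoidHom.mem_ker.2 ?_) g
  have h0 : Ideal.Quotient.mk (Ideal.span {n}) n = 0 :=
    Ideal.Quotient.eq_zero_iff_mem.2 (Ideal.mem_span_singleton_self n)
  ext i j
  fin_cases i <;> fin_cases j <;> simp [Matrix.GeneralLinearGroup.upperRightHom, h0]

/-- `Γ₀¹(𝔫)` is normal in `Γ₀(𝔫)`. -/
instance (n : Fq[X]) : ((Gamma01 n).subgroupOf (Gamma0 n)).Normal := by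
  rw [Gamma01, Subgroup.inf_subgroupOf_left]
  infer_instance

end Groups

/-! ### Drinfeld modular forms -/

section Forms

variable {Fq : Type*} [Field Fq] [Fintype Fq]

/-- `f(z) = ∑_{n ∈ ℤ} a_n (1 / e_{bA}(z)) ^ n` for all `z` with large imaginary part, with
`a_n = 0` for all `n < 0`. -/
def HasRegularExpansion (b : Fq[X]) (f : Omega Fq → Cinf Fq) : Prop :=
  ∃ a : ℤ → Cinf Fq, (∀ n < 0, a n = 0) ∧ ∃ R : ℝ, ∀ z : Omega Fq, R < imag (z : Cinf Fq) →
    HasSum (fun n : ℤ => a n * (1 / expLattice (principalLattice b) (z : Cinf Fq)) ^ n) (f z)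

/-- Holomorphy at the cusp `∞` of a function that is invariant under the unipotent elements of the
congruence group `Γ`, in terms of the expansions with respect to the subgroups `U_b ⊆ Γ`. -/
def IsHolomorphicAtInfty (Γ : Subgroup (GLA Fq)) (f : Omega Fq → Cinf Fq) : Prop :=
  ∀ b : Fq[X], b ≠ 0 → ContainsUnipotent Γ b → HasRegularExpansion b f

/-- `(f|_g)(z) = det(g) ^ m (c z + d) ^ (-k) f(g z)`. The power of `det(g) ∈ 𝔽_q^×` depends only on
`m` modulo `q - 1`. -/
def slash (k : ℕ) (m : ZMod (Fintype.card Fq - 1)) (g : GLA Fq) (f : Omega Fq → Cinf Fq) :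
    Omega Fq → Cinf Fq :=
  fun z => detC g ^ m.val * (denom g (z : Cinf Fq) ^ k)⁻¹ * f (moebius g z)

/-- `f` is a Drinfeld modular form of weight `k` and type `m` for the congruence group `Γ`. -/
structure IsModularForm (Γ : Subgroup (GLA Fq)) (k : ℕ) (m : ZMod (Fintype.card Fq - 1))
    (f : Omega Fq → Cinf Fq) : Prop where
  holomorphic : IsHolomorphic f
  transform : ∀ γ ∈ Γ, ∀ z : Omega Fq,
    f (moebius γ z) = (detC γ ^ m.val)⁻¹ * denom γ (z : Cinf Fq) ^ k * f z
  cusps : ∀ g : GLA Fq, IsHolomorphicAtInfty (conjGroup Γ g) (slash k m g f)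

theorem IsHolomorphic.zero : IsHolomorphic (0 : Omega Fq → Cinf Fq) := by
  intro n ε hε
  exact ⟨0, 1, by simp, by simpa using fun _ _ _ => hε⟩

theorem IsHolomorphic.add {f g : Omega Fq → Cinf Fq} (hf : IsHolomorphic f)
    (hg : IsHolomorphic g) : IsHolomorphic (f + g) := by
  intro n ε hε
  obtain ⟨p, r, hr, h⟩ := hf n (ε / 2) (by positivity)
  obtain ⟨p', r', hr', h'⟩ := hg n (ε / 2) (by positivity)
  refine ⟨p * r' + r * p', r * r', fun z hz => ?_, fun z hz => ?_⟩
  · rw [eval_mul]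
    exact mul_ne_zero (hr z hz) (hr' z hz)
  · have e : (f + g) z - (p * r' + r * p').eval (z : Cinf Fq) / (r * r').eval (z : Cinf Fq) =
        (f z - p.eval (z : Cinf Fq) / r.eval (z : Cinf Fq)) +
          (g z - p'.eval (z : Cinf Fq) / r'.eval (z : Cinf Fq)) := by
      simp only [eval_mul, eval_add, Pi.add_apply]
      rw [← div_add_div _ _ (hr z hz) (hr' z hz)]
      ring
    rw [e]
    linarith [norm_add_le (f z - p.eval (z : Cinf Fq) / r.eval (z : Cinf Fq))
      (g z - p'.eval (z : Cinf Fq) / r'.eval (z : Cinf Fq)), h z hz, h' z hz]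

theorem IsHolomorphic.smul (c : Cinf Fq) {f : Omega Fq → Cinf Fq} (hf : IsHolomorphic f) :
    IsHolomorphic (c • f) := by
  intro n ε hε
  obtain ⟨p, r, hr, h⟩ := hf n (ε / (‖c‖ + 1)) (by positivity)
  refine ⟨C c * p, r, hr, fun z hz => ?_⟩
  have e : (c • f) z - (C c * p).eval (z : Cinf Fq) / r.eval (z : Cinf Fq) =
      c * (f z - p.eval (z : Cinf Fq) / r.eval (z : Cinf Fq)) := by
    simp only [eval_mul, eval_C, Pi.smul_apply, smul_eq_mul]
    ring
  rw [e, norm_mul]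
  have h1 := h z hz
  rw [lt_div_iff₀ (by positivity)] at h1
  nlinarith [norm_nonneg (f z - p.eval (z : Cinf Fq) / r.eval (z : Cinf Fq))]

theorem HasRegularExpansion.add {b : Fq[X]} {f g : Omega Fq → Cinf Fq}
    (hf : HasRegularExpansion b f) (hg : HasRegularExpansion b g) :
    HasRegularExpansion b (f + g) := by
  obtain ⟨a, ha, R, h⟩ := hf
  obtain ⟨a', ha', R', h'⟩ := hg
  refine ⟨a + a', fun n hn => by simp [ha n hn, ha' n hn], max R R', fun z hz => ?_⟩
  simpa [add_mul] using (h z ((le_max_left _ _).trans_lt hz)).add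
    (h' z ((le_max_right _ _).trans_lt hz))

theorem HasRegularExpansion.smul {b : Fq[X]} (c : Cinf Fq) {f : Omega Fq → Cinf Fq}
    (hf : HasRegularExpansion b f) : HasRegularExpansion b (c • f) := by
  obtain ⟨a, ha, R, h⟩ := hf
  refine ⟨c • a, fun n hn => by simp [ha n hn], R, fun z hz => ?_⟩
  simpa [mul_assoc] using (h z hz).mul_left c

theorem HasRegularExpansion.zero (b : Fq[X]) :
    HasRegularExpansion b (0 : Omega Fq → Cinf Fq) :=
  ⟨0, by simp, 0, fun z _ => by simp⟩

theorem slash_add (k : ℕ) (m : ZMod (Fintype.card Fq - 1)) (g : GLA Fq)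
    (f f' : Omega Fq → Cinf Fq) : slash k m g (f + f') = slash k m g f + slash k m g f' := by
  funext z
  simp only [slash, Pi.add_apply]
  ring

theorem slash_smul (k : ℕ) (m : ZMod (Fintype.card Fq - 1)) (g : GLA Fq) (c : Cinf Fq)
    (f : Omega Fq → Cinf Fq) : slash k m g (c • f) = c • slash k m g f := by
  funext z
  simp only [slash, Pi.smul_apply, smul_eq_mul]
  ring

theorem slash_zero (k : ℕ) (m : ZMod (Fintype.card Fq - 1)) (g : GLA Fq) :
    slash k m g (0 : Omega Fq → Cinf Fq) = 0 := by
  funext z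
  simp [slash]

/-- The `ℂ_∞`-vector space `M_{k,m}(Γ)` of Drinfeld modular forms of weight `k` and type `m` for a
congruence subgroup `Γ` of `GL₂(A)`. -/
def modularForms (Γ : Subgroup (GLA Fq)) (_hΓ : IsCongruence Γ) (k : ℕ)
    (m : ZMod (Fintype.card Fq - 1)) : Submodule (Cinf Fq) (Omega Fq → Cinf Fq) where
  carrier := {f | IsModularForm Γ k m f}
  zero_mem' :=
    { holomorphic := IsHolomorphic.zero
      transform := by simp
      cusps := fun g b _ _ => by rw [slash_zero]; exact HasRegularExpansion.zero b }
  add_mem' {f f'} hf hf' :=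
    { holomorphic := hf.holomorphic.add hf'.holomorphic
      transform := fun γ hγ z => by
        simp only [Pi.add_apply, hf.transform γ hγ z, hf'.transform γ hγ z]; ring
      cusps := fun g b hb hU => by
        rw [slash_add]; exact (hf.cusps g b hb hU).add (hf'.cusps g b hb hU) }
  smul_mem' c f hf :=
    { holomorphic := hf.holomorphic.smul c
      transform := fun γ hγ z => by
        simp only [Pi.smul_apply, smul_eq_mul, hf.transform γ hγ z]; ring
      cusps := fun g b hb hU => by
        rw [slash_smul]; exact (hf.cusps g b hb hU).smul c }

/-- `M_{k,m}(Γ₀(𝔫))`. -/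
abbrev formsGamma0 {n : Fq[X]} (hn : n ≠ 0) (k : ℕ) (m : ZMod (Fintype.card Fq - 1)) :
    Submodule (Cinf Fq) (Omega Fq → Cinf Fq) :=
  modularForms (Gamma0 n) (gamma0_isCongruence hn) k m

/-- `M_{k,m}(Γ₀¹(𝔫))`. -/
abbrev formsGamma01 {n : Fq[X]} (hn : n ≠ 0) (k : ℕ) (m : ZMod (Fintype.card Fq - 1)) :
    Submodule (Cinf Fq) (Omega Fq → Cinf Fq) :=
  modularForms (Gamma01 n) (gamma01_isCongruence hn) k m

/-- The quotient `Γ₀(𝔫) / Γ₀¹(𝔫)`. -/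
abbrev quotGamma (n : Fq[X]) : Type _ := Gamma0 n ⧸ (Gamma01 n).subgroupOf (Gamma0 n)

end Forms

/-- The isotypic component of a representation attached to a one-dimensional character. -/
def charComponent {K G V : Type*} [Field K] [Group G] [AddCommGroup V] [Module K V]
    (ρ : Representation K G V) (χ : G →* Kˣ) : Submodule K V where
  carrier := {v | ∀ g : G, ρ g v = (χ g : K) • v}
  zero_mem' := by simp
  add_mem' {v w} hv hw g := by rw [map_add, hv g, hw g, smul_add]
  smul_mem' c v hv g := by rw [map_smul, hv g, smul_comm]

/-- The inclusion `𝔽_q^× ⊆ ℂ_∞^×`. -/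
def unitsToCinf (Fq : Type*) [Field Fq] [Fintype Fq] : Fqˣ →* (Cinf Fq)ˣ :=
  Units.map ((ofPoly Fq).comp (C : Fq →+* Fq[X])).toMonoidHom

end DrinfeldForms

end

open DrinfeldForms

noncomputable section

namespace DrinfeldForms

/-! ### Automorphy factors and the slash operator of type zero -/

section Slash

variable {Fq : Type*} [Field Fq] [Fintype Fq]

/-! Scalar matrices act trivially on `Ω`, and this forces the decomposition. The quotient `Γ₀(𝔫) /
Γ₀¹(𝔫)` is cyclic of order `q - 1`, with classes represented by the matrices `diagGL u 1`. On a form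
for `Γ₀¹(𝔫)` the operator `f ↦ f|_γ` depends only on `det γ` (`IsModularForm.slash_congr`), so the
quotient acts, and type `m` for `Γ₀(𝔫)` means that this action is by `det ^ (-m)`
(`isModularForm_gamma0_iff`).

Let `u` generate `𝔽_q^×` and let `x` be the class of `diagGL u 1`. The scalar matrix `diagGL u u`
also lies in the class `x ^ 2`; it fixes every `z` and acts in weight `2k` as `u ^ (-2k)`. Hence `x`
satisfies `X ^ 2 = u ^ (-2k)`. As `2` is invertible for odd `q`, the space splits into the
eigenspaces for `± u ^ (-k)` (`isCompl_charComponent`). Since `-1 = u ^ ((q - 1) / 2)`, these are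
the types `k` and `k + (q - 1) / 2`. The same scalar matrices force `2m = 2k` modulo `q - 1` for a
nonzero form, so no other type occurs. -/

theorem denom_ne_zero (γ : GLA Fq) (z : Omega Fq) : denom γ (z : Cinf Fq) ≠ 0 := by
  intro h
  apply moebius_mem γ z
  rw [h, div_zero]
  exact ⟨0, map_zero _⟩

theorem coe_moebius (γ : GLA Fq) (z : Omega Fq) :
    (moebius γ z : Cinf Fq) =
      (ofPoly Fq (γ 0 0) * (z : Cinf Fq) + ofPoly Fq (γ 0 1)) / denom γ (z : Cinf Fq) :=
  rfl

theorem denom_mul (γ δ : GLA Fq) (z : Omega Fq) :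
    denom (γ * δ) (z : Cinf Fq) = denom γ (moebius δ z : Cinf Fq) * denom δ (z : Cinf Fq) := by
  have h := denom_ne_zero δ z
  rw [denom, denom, coe_moebius, add_mul, mul_div_assoc', div_mul_cancel₀ _ h, denom]
  simp only [Matrix.GeneralLinearGroup.coe_mul, Matrix.mul_apply, Fin.sum_univ_two, map_add,
    map_mul]
  ring

theorem moebius_mul (γ δ : GLA Fq) (z : Omega Fq) :
    moebius (γ * δ) z = moebius γ (moebius δ z) := by
  have h := denom_ne_zero δ z
  have h' := denom_ne_zero γ (moebius δ z)
  refine Subtype.ext ?_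
  rw [coe_moebius, coe_moebius γ, denom_mul, div_eq_div_iff (mul_ne_zero h' h) h',
    mul_comm (denom γ _) (denom δ _), ← mul_assoc]
  congr 1
  rw [coe_moebius, add_mul, mul_div_assoc', div_mul_cancel₀ _ h, denom]
  simp only [Matrix.GeneralLinearGroup.coe_mul, Matrix.mul_apply, Fin.sum_univ_two, map_add,
    map_mul]
  ring

theorem slash_type_zero_apply (k : ℕ) (g : GLA Fq) (f : Omega Fq → Cinf Fq) (z : Omega Fq) :
    slash k 0 g f z = (denom g (z : Cinf Fq) ^ k)⁻¹ * f (moebius g z) := by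
  simp [slash]

/-- The type enters only through a nonzero constant, so cusp conditions can be moved between types.
-/
theorem slash_eq_smul (k : ℕ) (m : ZMod (Fintype.card Fq - 1)) (g : GLA Fq)
    (f : Omega Fq → Cinf Fq) : slash k m g f = detC g ^ m.val • slash k 0 g f := by
  funext z
  simp [slash, mul_assoc]

theorem slash_mul (k : ℕ) (γ δ : GLA Fq) (f : Omega Fq → Cinf Fq) :
    slash k 0 (γ * δ) f = slash k 0 δ (slash k 0 γ f) := by
  funext z
  simp only [slash_type_zero_apply, denom_mul, moebius_mul, mul_pow, mul_inv]
  ring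

theorem denom_one (z : Omega Fq) : denom (1 : GLA Fq) (z : Cinf Fq) = 1 := by
  simp [denom]

theorem moebius_one (z : Omega Fq) : moebius (1 : GLA Fq) z = z := by
  refine Subtype.ext ?_
  rw [coe_moebius, denom_one]
  simp

theorem slash_one (k : ℕ) (f : Omega Fq → Cinf Fq) : slash k 0 1 f = f := by
  funext z
  simp [slash_type_zero_apply, denom_one, moebius_one]

end Slash

/-! ### Constant diagonal matrices -/

section Diagonal

variable {Fq : Type*} [Field Fq]

/-- The matrix `(u 0; 0 v)` with constant entries. -/
def diagGL (u v : Fqˣ) : GLA Fq where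
  val := !![C (u : Fq), 0; 0, C (v : Fq)]
  inv := !![C ((u⁻¹ : Fqˣ) : Fq), 0; 0, C ((v⁻¹ : Fqˣ) : Fq)]
  val_inv := by
    rw [Matrix.mul_fin_two, Matrix.one_fin_two]
    simp [← C_mul]
  inv_val := by
    rw [Matrix.mul_fin_two, Matrix.one_fin_two]
    simp [← C_mul]

theorem coe_diagGL (u v : Fqˣ) :
    (diagGL u v : Matrix (Fin 2) (Fin 2) Fq[X]) = !![C (u : Fq), 0; 0, C (v : Fq)] :=
  rfl

theorem det_diagGL (u v : Fqˣ) : ((diagGL u v).det : Fq[X]) = C ((u * v : Fqˣ) : Fq) := by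
  rw [Matrix.GeneralLinearGroup.val_det_apply, coe_diagGL, Matrix.det_fin_two]
  simp

theorem diagGL_mem_gamma0 (n : Fq[X]) (u v : Fqˣ) : diagGL u v ∈ Gamma0 n := by
  change n ∣ (diagGL u v : Matrix (Fin 2) (Fin 2) Fq[X]) 1 0
  simp [coe_diagGL]

variable [Fintype Fq]

theorem coe_unitsToCinf (u : Fqˣ) : (unitsToCinf Fq u : Cinf Fq) = ofPoly Fq (C (u : Fq)) :=
  rfl

theorem denom_diagGL (u v : Fqˣ) (z : Cinf Fq) : denom (diagGL u v) z = unitsToCinf Fq v := by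
  simp [denom, coe_diagGL, coe_unitsToCinf]

theorem coe_moebius_diagGL (u v : Fqˣ) (z : Omega Fq) :
    (moebius (diagGL u v) z : Cinf Fq) = unitsToCinf Fq u * z / unitsToCinf Fq v := by
  rw [coe_moebius, denom_diagGL]
  simp [coe_diagGL, coe_unitsToCinf]

theorem moebius_diagGL_self (u : Fqˣ) (z : Omega Fq) : moebius (diagGL u u) z = z := by
  refine Subtype.ext ?_
  rw [coe_moebius_diagGL, mul_div_cancel_left₀ _ (Units.ne_zero _)]

theorem norm_unitsToCinf (u : Fqˣ) : ‖(unitsToCinf Fq u : Cinf Fq)‖ = 1 := by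
  classical
  have h : (unitsToCinf Fq u : Cinf Fq) ^ Fintype.card Fqˣ = 1 := by
    rw [← Units.val_pow_eq_pow_val, ← map_pow, pow_card_eq_one, map_one, Units.val_one]
  have h' := congrArg norm h
  rw [norm_pow, norm_one] at h'
  exact (pow_eq_one_iff_of_nonneg (norm_nonneg _) Fintype.card_ne_zero).1 h'

/-- Scaling by a constant is an isometry of `ℂ_∞` that permutes `F_∞`. -/
theorem imag_unitsToCinf_mul (u : Fqˣ) (z : Cinf Fq) :
    imag ((unitsToCinf Fq u : Cinf Fq) * z) = imag z := by
  have hu : ofPolyInf Fq (C (u : Fq)) ≠ 0 :=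
    (map_ne_zero_iff _ ofPolyInf_injective).2 (by simp)
  refine ((Equiv.mulLeft₀ _ hu).iInf_congr fun α => ?_).symm
  rw [Equiv.mulLeft₀_apply, map_mul]
  change ‖(unitsToCinf Fq u : Cinf Fq) * z -
    (unitsToCinf Fq u : Cinf Fq) * algebraMap (Finf Fq) (Cinf Fq) α‖ = _
  rw [← mul_sub, norm_mul, norm_unitsToCinf, one_mul]

theorem moebius_diagGL_mem_affinoid (u : Fqˣ) {N : ℕ} {z : Omega Fq} (hz : z ∈ affinoid Fq N) :
    moebius (diagGL u 1) z ∈ affinoid Fq N := by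
  have h : (moebius (diagGL u 1) z : Cinf Fq) = unitsToCinf Fq u * z := by
    simp [coe_moebius_diagGL]
  refine ⟨?_, ?_⟩
  · rw [h, norm_mul, norm_unitsToCinf, one_mul]
    exact hz.1
  · rw [h, imag_unitsToCinf_mul]
    exact hz.2

/-- The affinoids are stable under `z ↦ u z` and the automorphy factor of `diagGL u 1` is `1`, so
substituting `u X` into the approximating fractions is enough. -/
theorem IsHolomorphic.slash_diagGL {f : Omega Fq → Cinf Fq} (hf : IsHolomorphic f) (k : ℕ)
    (u : Fqˣ) : IsHolomorphic (slash k 0 (diagGL u 1) f) := by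
  intro N ε hε
  obtain ⟨p, r, hr, h⟩ := hf N ε hε
  have key : ∀ (s : (Cinf Fq)[X]) (z : Omega Fq),
      (s.comp (C (unitsToCinf Fq u : Cinf Fq) * X)).eval (z : Cinf Fq) =
        s.eval (moebius (diagGL u 1) z : Cinf Fq) := by
    intro s z
    simp [coe_moebius_diagGL]
  refine ⟨p.comp (C (unitsToCinf Fq u : Cinf Fq) * X), r.comp (C (unitsToCinf Fq u : Cinf Fq) * X),
    fun z hz => ?_, fun z hz => ?_⟩
  · rw [key]
    exact hr _ (moebius_diagGL_mem_affinoid u hz)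
  · rw [key, key, slash_type_zero_apply, denom_diagGL]
    simpa using h _ (moebius_diagGL_mem_affinoid u hz)

end Diagonal

/-! ### The quotient `Γ₀(𝔫) / Γ₀¹(𝔫)` -/

section Quotient

variable {Fq : Type*} [Field Fq]

/-- The determinant of an element of `GL₂(A)` as an element of `𝔽_q^×`. -/
def detUnit : GLA Fq →* Fqˣ :=
  (Units.map (evalRingHom (0 : Fq)).toMonoidHom).comp Matrix.GeneralLinearGroup.det

/-- Units of `𝔽_q[T]` are constants, so evaluation at `0` loses nothing. -/
theorem C_detUnit (γ : GLA Fq) : C (detUnit γ : Fq) = (γ.det : Fq[X]) := by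
  obtain ⟨c, -, hc⟩ := Polynomial.isUnit_iff.1 γ.det.isUnit
  change C ((γ.det : Fq[X]).eval 0) = _
  rw [← hc, eval_C]

theorem detUnit_eq_iff {γ : GLA Fq} {u : Fqˣ} : detUnit γ = u ↔ (γ.det : Fq[X]) = C (u : Fq) := by
  rw [← C_detUnit, C_inj, Units.val_inj]

theorem detUnit_diagGL (u v : Fqˣ) : detUnit (diagGL u v) = u * v :=
  detUnit_eq_iff.2 (det_diagGL u v)

theorem mem_gamma01_iff {n : Fq[X]} {γ : GLA Fq} :
    γ ∈ Gamma01 n ↔ γ ∈ Gamma0 n ∧ detUnit γ = 1 := by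
  rw [Gamma01, Subgroup.mem_inf, MonoidHom.mem_ker, detUnit_eq_iff, ← Units.val_inj]
  simp

/-- The isomorphism `Γ₀(𝔫) / Γ₀¹(𝔫) ≅ 𝔽_q^×` induced by the determinant. -/
def quotGammaEquiv (n : Fq[X]) : quotGamma n ≃* Fqˣ :=
  QuotientGroup.liftEquiv (φ := detUnit.comp (Gamma0 n).subtype) _
    (fun u => ⟨⟨diagGL u 1, diagGL_mem_gamma0 n u 1⟩, by simp [detUnit_diagGL]⟩) (by
      ext γ
      simp [Subgroup.mem_subgroupOf, mem_gamma01_iff, MonoidHom.mem_ker])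

theorem quotGammaEquiv_coe {n : Fq[X]} (γ : Gamma0 n) :
    quotGammaEquiv n (γ : quotGamma n) = detUnit (γ : GLA Fq) :=
  rfl

/-- Conjugates of unipotent matrices have determinant `1`. Thus the cusp conditions for the two
groups run over the same `b`. -/
theorem containsUnipotent_conj_gamma01_iff {n b : Fq[X]} {g : GLA Fq} :
    ContainsUnipotent (conjGroup (Gamma01 n) g) b ↔
      ContainsUnipotent (conjGroup (Gamma0 n) g) b := by
  refine forall_congr' fun a => ?_
  have h : detUnit (Matrix.GeneralLinearGroup.upperRightHom (b * a) : GLA Fq) = 1 := by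
    rw [detUnit_eq_iff]
    simp [Matrix.GeneralLinearGroup.upperRightHom]
  simp only [conjGroup, Subgroup.mem_comap, mem_gamma01_iff, MulEquiv.coe_toMonoidHom,
    MulAut.conj_apply, map_mul, map_inv, h, mul_one, mul_inv_cancel, and_true]

/-- `Γ₀(𝔫)` normalises `Γ₀¹(𝔫)`; this turns the cusp condition of `f|_γ` at `g` into that of `f` at
`γ g`. -/
theorem conjGroup_gamma01_mul {n : Fq[X]} {γ : GLA Fq} (hγ : γ ∈ Gamma0 n) (g : GLA Fq) :
    conjGroup (Gamma01 n) (γ * g) = conjGroup (Gamma01 n) g := by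
  ext x
  simp only [conjGroup, Subgroup.mem_comap, mem_gamma01_iff, MulEquiv.coe_toMonoidHom,
    MulAut.conj_apply]
  refine and_congr ?_ (by
    simp only [map_mul, map_inv, mul_inv_cancel_comm])
  rw [show γ * g * x * (γ * g)⁻¹ = γ * (g * x * g⁻¹) * γ⁻¹ by group,
    Subgroup.mul_mem_cancel_right _ (inv_mem hγ), Subgroup.mul_mem_cancel_left _ hγ]

variable [Fintype Fq]

theorem detC_eq (γ : GLA Fq) : detC γ = unitsToCinf Fq (detUnit γ) := by
  rw [detC, ← C_detUnit, coe_unitsToCinf]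

theorem unitsToCinf_injective : Function.Injective (unitsToCinf Fq) := by
  refine Units.map_injective ?_
  exact RingHom.injective ((ofPoly Fq).comp (C : Fq →+* Fq[X]))

end Quotient

/-! ### The action on the forms for `Γ₀¹(𝔫)` -/

section Action

variable {Fq : Type*} [Field Fq] [Fintype Fq] {n : Fq[X]} {k : ℕ}

/-- This form of the transformation law is an eigenvector equation for the type-zero operator. -/
theorem forall_transform_iff_slash {m : ZMod (Fintype.card Fq - 1)} {f : Omega Fq → Cinf Fq}
    {γ : GLA Fq} :
    (∀ z : Omega Fq, f (moebius γ z) = (detC γ ^ m.val)⁻¹ * denom γ (z : Cinf Fq) ^ k * f z) ↔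
      slash k 0 γ f = (detC γ ^ m.val)⁻¹ • f := by
  rw [funext_iff]
  refine forall_congr' fun z => ?_
  rw [slash_type_zero_apply, inv_mul_eq_iff_eq_mul₀ (pow_ne_zero _ (denom_ne_zero γ z))]
  simp only [Pi.smul_apply, smul_eq_mul]
  rw [mul_left_comm, mul_assoc]

theorem IsModularForm.slash_eq_self {f : Omega Fq → Cinf Fq}
    (hf : IsModularForm (Gamma01 n) k 0 f) {γ : GLA Fq} (hγ : γ ∈ Gamma01 n) :
    slash k 0 γ f = f := by
  simpa using forall_transform_iff_slash.1 (hf.transform γ hγ)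

theorem IsModularForm.slash_congr {f : Omega Fq → Cinf Fq}
    (hf : IsModularForm (Gamma01 n) k 0 f) {γ δ : GLA Fq} (hγ : γ ∈ Gamma0 n)
    (hδ : δ ∈ Gamma0 n) (h : detUnit γ = detUnit δ) : slash k 0 γ f = slash k 0 δ f := by
  have hmem : γ * δ⁻¹ ∈ Gamma01 n :=
    mem_gamma01_iff.2 ⟨mul_mem hγ (inv_mem hδ), by simp [h]⟩
  rw [← inv_mul_cancel_right γ δ, slash_mul, hf.slash_eq_self hmem]

theorem IsModularForm.slash {f : Omega Fq → Cinf Fq} (hf : IsModularForm (Gamma01 n) k 0 f)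
    {γ : GLA Fq} (hγ : γ ∈ Gamma0 n) : IsModularForm (Gamma01 n) k 0 (slash k 0 γ f) where
  holomorphic := by
    -- Only the determinant of `γ` matters, so the diagonal representative reduces holomorphy to a
    -- scaling of `z`.
    rw [hf.slash_congr hγ (diagGL_mem_gamma0 n (detUnit γ) 1) (by simp [detUnit_diagGL])]
    exact hf.holomorphic.slash_diagGL k _
  transform δ hδ := by
    rw [forall_transform_iff_slash, ← slash_mul]
    have hδ' := mem_gamma01_iff.1 hδ
    simpa using hf.slash_congr (mul_mem hγ hδ'.1) hγ (by simp [hδ'.2])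
  cusps g b hb hU := by
    rw [← slash_mul]
    exact hf.cusps (γ * g) b hb (by rwa [conjGroup_gamma01_mul hγ])

theorem isModularForm_gamma0_iff {m : ZMod (Fintype.card Fq - 1)} {f : Omega Fq → Cinf Fq} :
    IsModularForm (Gamma0 n) k m f ↔ IsModularForm (Gamma01 n) k 0 f ∧
      ∀ γ ∈ Gamma0 n, slash k 0 γ f = (detC γ ^ m.val)⁻¹ • f := by
  have hdet : ∀ g : GLA Fq, detC g ^ m.val ≠ 0 := fun g => by
    rw [detC_eq]
    exact pow_ne_zero _ (Units.ne_zero _)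
  refine ⟨fun hf => ⟨⟨hf.holomorphic, fun γ hγ => ?_, fun g b hb hU => ?_⟩, fun γ hγ => ?_⟩,
    fun ⟨hf, h⟩ => ⟨hf.holomorphic, fun γ hγ => ?_, fun g b hb hU => ?_⟩⟩
  · have hγ' := mem_gamma01_iff.1 hγ
    have := hf.transform γ hγ'.1
    simpa [detC_eq, hγ'.2] using this
  · have := (hf.cusps g b hb (containsUnipotent_conj_gamma01_iff.1 hU)).smul (detC g ^ m.val)⁻¹
    rwa [slash_eq_smul, inv_smul_smul₀ (hdet g)] at this
  · exact forall_transform_iff_slash.1 (hf.transform γ hγ)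
  · exact forall_transform_iff_slash.2 (h γ hγ)
  · rw [slash_eq_smul]
    exact (hf.cusps g b hb (containsUnipotent_conj_gamma01_iff.2 hU)).smul _

/-- The operator `f ↦ f|_γ` on `M_{k,0}(Γ₀¹(𝔫))` for `γ ∈ Γ₀(𝔫)`. -/
def slashEnd (hn : n ≠ 0) (k : ℕ) (γ : Gamma0 n) : Module.End (Cinf Fq) (formsGamma01 hn k 0) where
  toFun f := ⟨slash k 0 (γ : GLA Fq) f, IsModularForm.slash f.2 γ.2⟩
  map_add' _ _ := Subtype.ext (slash_add k 0 _ _ _)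
  map_smul' c _ := Subtype.ext (slash_smul k 0 _ c _)

theorem slashEnd_congr (hn : n ≠ 0) (k : ℕ) {γ δ : Gamma0 n}
    (h : detUnit (γ : GLA Fq) = detUnit (δ : GLA Fq)) : slashEnd hn k γ = slashEnd hn k δ :=
  LinearMap.ext fun f => Subtype.ext (IsModularForm.slash_congr f.2 γ.2 δ.2 h)

/-- The representation of `Γ₀(𝔫) / Γ₀¹(𝔫)` on `M_{k,0}(Γ₀¹(𝔫))` given by `f ↦ f|_γ`. -/
def quotRep (hn : n ≠ 0) (k : ℕ) :
    Representation (Cinf Fq) (quotGamma n) (formsGamma01 hn k 0) :=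
  QuotientGroup.lift _
    { toFun := slashEnd hn k
      map_one' := LinearMap.ext fun f => Subtype.ext (slash_one k _)
      map_mul' := fun γ δ => by
        -- The slash operator is a right action; since `γ δ` and `δ γ` have equal determinant, it is
        -- also a left action here.
        rw [slashEnd_congr hn k (δ := δ * γ) (by simp [mul_comm])]
        exact LinearMap.ext fun f => Subtype.ext (slash_mul k _ _ _) }
    (fun γ hγ => LinearMap.ext fun f => Subtype.ext (IsModularForm.slash_eq_self f.2 hγ))

theorem quotRep_coe_apply (hn : n ≠ 0) (γ : Gamma0 n) (f : formsGamma01 hn k 0) :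
    (quotRep hn k (γ : quotGamma n) f : Omega Fq → Cinf Fq) = slash k 0 (γ : GLA Fq) f :=
  rfl

/-- The character `det ^ (-m)` of `Γ₀(𝔫) / Γ₀¹(𝔫)`. -/
abbrev detChar (n : Fq[X]) (m : ZMod (Fintype.card Fq - 1)) : quotGamma n →* (Cinf Fq)ˣ :=
  (((unitsToCinf Fq).comp (quotGammaEquiv n).toMonoidHom) ^ m.val)⁻¹

theorem formsGamma0_eq_map_charComponent (hn : n ≠ 0) (m : ZMod (Fintype.card Fq - 1)) :
    formsGamma0 hn k m =
      (charComponent (quotRep hn k) (detChar n m)).map (formsGamma01 hn k 0).subtype := by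
  have hχ : ∀ γ : Gamma0 n, (detChar n m (γ : quotGamma n) : Cinf Fq) =
      (detC (γ : GLA Fq) ^ m.val)⁻¹ := fun γ => by
    rw [detC_eq, ← quotGammaEquiv_coe]
    simp
  ext f
  refine (isModularForm_gamma0_iff (m := m)).trans ⟨fun ⟨hf, h⟩ => ?_, ?_⟩
  · refine ⟨⟨f, hf⟩, fun g => ?_, rfl⟩
    induction g using QuotientGroup.induction_on with
    | H γ => exact Subtype.ext ((h γ γ.2).trans (by rw [hχ]; rfl))
  · rintro ⟨⟨f, hf⟩, h, rfl⟩
    refine ⟨hf, fun γ hγ => ?_⟩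
    have := congrArg Subtype.val (h ((⟨γ, hγ⟩ : Gamma0 n) : quotGamma n))
    rw [hχ] at this
    exact this

end Action

/-! ### Weights and types -/

section Types

variable {Fq : Type*} [Field Fq] [Fintype Fq] {n : Fq[X]}

/-- `u ^ (q - 1) = 1`, so exponents may be reduced modulo `q - 1`. -/
theorem unitsToCinf_pow_val (u : Fqˣ) (j : ℕ) :
    (unitsToCinf Fq u) ^ (j : ZMod (Fintype.card Fq - 1)).val = unitsToCinf Fq u ^ j := by
  classical
  rw [← map_pow, ← map_pow, ZMod.val_natCast, ← Fintype.card_units, pow_mod_card]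

/-- A nonzero form for `Γ₀(𝔫)` of weight `k` and type `m` satisfies `2 m ≡ k` modulo `q - 1`. -/
theorem two_mul_type_eq_weight (hn : n ≠ 0) {k : ℕ} {m : ZMod (Fintype.card Fq - 1)}
    (h : formsGamma0 hn k m ≠ ⊥) : 2 * m = (k : ZMod (Fintype.card Fq - 1)) := by
  classical
  obtain ⟨f, hf, hf0⟩ := (Submodule.ne_bot_iff _).1 h
  obtain ⟨z, hz⟩ := Function.ne_iff.1 hf0
  obtain ⟨u, hu⟩ := IsCyclic.exists_generator (α := Fqˣ)
  have hcard : Fintype.card Fqˣ = Fintype.card Fq - 1 := Fintype.card_units _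
  have : NeZero (Fintype.card Fq - 1) := ⟨by rw [← hcard]; exact Fintype.card_ne_zero⟩
  -- The scalar matrix fixes `z`, so cancelling `f z ≠ 0` leaves `(u * u) ^ m = u ^ k` in `ℂ_∞`. A
  -- generator `u` then compares exponents modulo `q - 1`.
  have ht := IsModularForm.transform hf _ (diagGL_mem_gamma0 n u u) z
  rw [moebius_diagGL_self, denom_diagGL, detC_eq, detUnit_diagGL, eq_comm, mul_eq_right₀ hz,
    inv_mul_eq_one₀ (pow_ne_zero _ (Units.ne_zero _))] at ht
  have ht' : (u * u) ^ m.val = u ^ k := by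
    apply unitsToCinf_injective
    apply Units.ext
    simpa using ht
  rw [← pow_two, ← pow_mul, pow_eq_pow_iff_modEq, orderOf_eq_card_of_forall_mem_zpowers hu,
    Nat.card_eq_fintype_card, hcard, ← ZMod.natCast_eq_natCast_iff] at ht'
  simpa using ht'

theorem eq_or_eq_add_half_of_two_mul_eq {N : ℕ} (hN : N ≠ 0) (hN2 : Even N) {m : ZMod N} {k : ℕ}
    (h : 2 * m = ((2 * k : ℕ) : ZMod N)) : m = k ∨ m = ((k + N / 2 : ℕ) : ZMod N) := by
  have : NeZero N := ⟨hN⟩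
  obtain ⟨M, rfl⟩ := hN2
  rw [← ZMod.natCast_zmod_val m] at h ⊢
  generalize m.val = j at h ⊢
  have h' : ((2 * j : ℕ) : ZMod (M + M)) = ((2 * k : ℕ) : ZMod (M + M)) := by
    simpa using h
  rw [ZMod.natCast_eq_natCast_iff, ← two_mul] at h'
  have h2 : j ≡ k [MOD M] := Nat.ModEq.mul_left_cancel' two_ne_zero h'
  rw [ZMod.natCast_eq_natCast_iff, ZMod.natCast_eq_natCast_iff]
  rw [← two_mul, Nat.mul_div_cancel_left M two_pos]
  have hM : 0 < M := by omega
  have h3 : (j : ℤ) ≡ k [ZMOD M] := (Int.natCast_modEq_iff).2 h2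
  obtain ⟨c, hc⟩ := h3.dvd
  rw [← Int.natCast_modEq_iff, ← Int.natCast_modEq_iff, Int.modEq_iff_dvd, Int.modEq_iff_dvd]
  push_cast
  -- Here `k - j = M c` with modulus `2M`: even `c` gives `j ≡ k`, odd `c` gives `j ≡ k + M`.
  obtain ⟨d, hd | hd⟩ := Int.even_or_odd' c
  · exact Or.inl ⟨d, by rw [hc, hd]; ring⟩
  · exact Or.inr ⟨d + 1, by linear_combination hc + (M : ℤ) * hd⟩

/-- The power is a square root of `1`, and it is not `1` because `u` has order `q - 1`. -/
theorem unitsToCinf_generator_pow_half (hq : Odd (Fintype.card Fq)) {u : Fqˣ}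
    (hu : ∀ x, x ∈ Subgroup.zpowers u) :
    (unitsToCinf Fq u : Cinf Fq) ^ ((Fintype.card Fq - 1) / 2) = -1 := by
  classical
  have hcard : orderOf u = Fintype.card Fq - 1 := by
    rw [orderOf_eq_card_of_forall_mem_zpowers hu, Nat.card_eq_fintype_card, Fintype.card_units]
  obtain ⟨M, hM⟩ := hq
  have hM0 : M ≠ 0 := by
    have := Fintype.one_lt_card (α := Fq)
    omega
  have e1 : (Fintype.card Fq - 1) / 2 = M := by omega
  rw [e1]
  have hne : (unitsToCinf Fq u : Cinf Fq) ^ M ≠ 1 := by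
    intro h
    have h' : u ^ M = 1 := by
      apply unitsToCinf_injective
      apply Units.ext
      simpa using h
    have := Nat.le_of_dvd (Nat.pos_of_ne_zero hM0) (orderOf_dvd_of_pow_eq_one h')
    omega
  have hsq : ((unitsToCinf Fq u : Cinf Fq) ^ M) ^ 2 = 1 := by
    rw [← pow_mul, ← Units.val_pow_eq_pow_val, ← map_pow, mul_comm,
      show 2 * M = orderOf u by omega, pow_orderOf_eq_one, map_one, Units.val_one]
  exact (sq_eq_one_iff.1 hsq).resolve_left hne

theorem two_ne_zero_cinf (hq : Odd (Fintype.card Fq)) : (2 : Cinf Fq) ≠ 0 := by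
  have h2 : (2 : Fq) ≠ 0 := Ring.two_ne_zero fun h => by
    have := FiniteField.even_card_iff_char_two.1 h
    rw [Nat.odd_iff] at hq
    omega
  have h := (map_ne_zero ((ofPoly Fq).comp (C : Fq →+* Fq[X]))).2 h2
  rwa [map_ofNat] at h

end Types

/-! ### Decomposition under a cyclic group acting through two opposite characters -/

section Components

variable {K G V : Type*} [Field K] [Group G] [Finite G] [AddCommGroup V] [Module K V]
  {ρ : Representation K G V}

theorem mem_charComponent_iff_of_generator {χ : G →* Kˣ} {x : G}
    (hx : ∀ g, g ∈ Subgroup.zpowers x) {v : V} :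
    v ∈ charComponent ρ χ ↔ ρ x v = (χ x : K) • v := by
  refine ⟨fun h => h x, fun h g => ?_⟩
  -- Finiteness of `G` makes every element a nonnegative power of `x`, so induction on the exponent
  -- suffices.
  obtain ⟨i, rfl⟩ := mem_powers_iff_mem_zpowers.2 (hx g)
  induction i with
  | zero => simp
  | succ i ih =>
    simp only at ih ⊢
    rw [pow_succ, map_mul, Module.End.mul_apply, h, map_smul, ih, smul_smul, map_mul,
      Units.val_mul, mul_comm]

/-- With `c = χ x`, the operator `ρ x` is a root of `X ^ 2 - c ^ 2 = (X - c) (X + c)`. The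
projections onto the two eigenspaces are `(1 ± c⁻¹ ρ x) / 2`. -/
theorem isCompl_charComponent {χ ψ : G →* Kˣ} {x : G} (hx : ∀ g, g ∈ Subgroup.zpowers x)
    (h2 : (2 : K) ≠ 0) (hχψ : (ψ x : K) = -(χ x : K))
    (hρ : ∀ v, ρ x (ρ x v) = (χ x : K) ^ 2 • v) :
    IsCompl (charComponent ρ χ) (charComponent ρ ψ) := by
  have hc : (χ x : K) ≠ 0 := Units.ne_zero _
  refine ⟨Submodule.disjoint_def.2 fun v hv hw => ?_, codisjoint_iff.2 (eq_top_iff.2 fun v _ => ?_)⟩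
  · have h := hv x
    rw [hw x, hχψ, neg_smul, neg_eq_iff_add_eq_zero, ← two_smul K, smul_smul] at h
    exact (smul_eq_zero.1 h).resolve_left (mul_ne_zero h2 hc)
  · refine Submodule.mem_sup.2 ⟨(2 : K)⁻¹ • (v + (χ x : K)⁻¹ • ρ x v), ?_,
      (2 : K)⁻¹ • (v - (χ x : K)⁻¹ • ρ x v), ?_, ?_⟩
    · rw [mem_charComponent_iff_of_generator hx]
      simp only [map_smul, map_add, hρ]
      match_scalars <;> field_simp
    · rw [mem_charComponent_iff_of_generator hx, hχψ]
      simp only [map_smul, map_sub, hρ]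
      match_scalars <;> field_simp
    · match_scalars
      · field_simp
        norm_num
      · ring

end Components

/-! ### The two eigenspaces of a generator of `Γ₀(𝔫) / Γ₀¹(𝔫)` -/

section Decomposition

variable {Fq : Type*} [Field Fq] [Fintype Fq]

instance (n : Fq[X]) : Finite (quotGamma n) :=
  Finite.of_equiv _ (quotGammaEquiv n).symm.toEquiv

theorem isCompl_charComponent_quotRep (hq : Odd (Fintype.card Fq)) {n : Fq[X]} (hn : n ≠ 0)
    (k : ℕ) :
    IsCompl (charComponent (quotRep hn (2 * k)) (detChar n (k : ZMod (Fintype.card Fq - 1))))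
      (charComponent (quotRep hn (2 * k)) (detChar n
        ((k + (Fintype.card Fq - 1) / 2 : ℕ) : ZMod (Fintype.card Fq - 1)))) := by
  obtain ⟨u, hu⟩ := IsCyclic.exists_generator (α := Fqˣ)
  let γ : Gamma0 n := ⟨diagGL u 1, diagGL_mem_gamma0 n u 1⟩
  have hγ : quotGammaEquiv n (γ : quotGamma n) = u := by
    rw [quotGammaEquiv_coe, detUnit_diagGL, mul_one]
  have hχ : ∀ j : ℕ, (detChar n (j : ZMod (Fintype.card Fq - 1)) (γ : quotGamma n) : Cinf Fq) =
      ((unitsToCinf Fq u : Cinf Fq) ^ j)⁻¹ := fun j => by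
    rw [← Units.val_pow_eq_pow_val, ← unitsToCinf_pow_val, ← hγ]
    simp
  refine isCompl_charComponent (x := (γ : quotGamma n)) (fun g => ?_) (two_ne_zero_cinf hq) ?_
    fun f => ?_
  · obtain ⟨i, hi⟩ := hu (quotGammaEquiv n g)
    refine ⟨i, (quotGammaEquiv n).injective ?_⟩
    rw [← hi, map_zpow, hγ]
  · rw [hχ, hχ, pow_add, unitsToCinf_generator_pow_half hq hu, mul_neg_one, inv_neg]
  · refine Subtype.ext ?_
    rw [quotRep_coe_apply, quotRep_coe_apply, ← slash_mul,
      -- `γ ^ 2` and the scalar matrix `diagGL u u` both have determinant `u ^ 2`, and the latter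
      -- acts as `u ^ (-2k)`.
      IsModularForm.slash_congr f.2 (mul_mem γ.2 γ.2) (diagGL_mem_gamma0 n u u)
        (by simp [γ, detUnit_diagGL]), hχ]
    funext z
    simp only [slash_type_zero_apply, denom_diagGL, moebius_diagGL_self, Submodule.coe_smul,
      Pi.smul_apply, smul_eq_mul, inv_pow, ← pow_mul, mul_comm k 2]

end Decomposition

end DrinfeldForms

end

theorem mainTheorem9 (Fq : Type*) [Field Fq] [Fintype Fq] (hq : Odd (Fintype.card Fq))
    (n : Fq[X]) (hn : n ≠ 0) (k : ℕ) :
    -- the direct sum decomposition, inside the space of functions on `Ω`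
    (formsGamma01 hn (2 * k) 0 =
        formsGamma0 hn (2 * k) (k : ZMod (Fintype.card Fq - 1)) ⊔
        formsGamma0 hn (2 * k) ((k + (Fintype.card Fq - 1) / 2 : ℕ) : ZMod (Fintype.card Fq - 1)) ∧
      Disjoint (formsGamma0 hn (2 * k) (k : ZMod (Fintype.card Fq - 1)))
        (formsGamma0 hn (2 * k)
          ((k + (Fintype.card Fq - 1) / 2 : ℕ) : ZMod (Fintype.card Fq - 1)))) ∧
    -- the determinant induces an isomorphism `Γ₀(𝔫) / Γ₀¹(𝔫) ≅ 𝔽_q^×`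
    ∃ φ : quotGamma n ≃* Fqˣ,
      (∀ γ : Gamma0 n, C ((φ (γ : quotGamma n) : Fqˣ) : Fq) = ((γ : GLA Fq).det : Fq[X])) ∧
      -- this quotient acts on `M_{2k,0}(Γ₀¹(𝔫))` by `f ↦ f|_γ`
      ∃ ρ : Representation (Cinf Fq) (quotGamma n) (formsGamma01 hn (2 * k) 0),
        (∀ (γ : Gamma0 n) (f : formsGamma01 hn (2 * k) 0),
          (ρ (γ : quotGamma n) f : Omega Fq → Cinf Fq) = slash (2 * k) 0 (γ : GLA Fq) f) ∧
        -- the forms of type `m` are the isotypic component of the character `det ^ (-m)`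
        (∀ m : ZMod (Fintype.card Fq - 1),
          formsGamma0 hn (2 * k) m =
            (charComponent ρ ((((unitsToCinf Fq).comp φ.toMonoidHom) ^ m.val)⁻¹)).map
              (formsGamma01 hn (2 * k) 0).subtype) ∧
        -- all other isotypic components vanish
        (∀ m : ZMod (Fintype.card Fq - 1), m ≠ (k : ZMod (Fintype.card Fq - 1)) →
          m ≠ ((k + (Fintype.card Fq - 1) / 2 : ℕ) : ZMod (Fintype.card Fq - 1)) →
          formsGamma0 hn (2 * k) m = ⊥) := by
  have hdec := isCompl_charComponent_quotRep hq hn k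
  refine ⟨⟨?_, ?_⟩, quotGammaEquiv n, fun γ => by rw [quotGammaEquiv_coe, C_detUnit],
    quotRep hn (2 * k), quotRep_coe_apply hn, formsGamma0_eq_map_charComponent hn,
    fun m hm hm' => ?_⟩
  · rw [formsGamma0_eq_map_charComponent hn, formsGamma0_eq_map_charComponent hn,
      ← Submodule.map_sup, hdec.sup_eq_top, Submodule.map_subtype_top]
  · rw [formsGamma0_eq_map_charComponent hn, formsGamma0_eq_map_charComponent hn]
    exact (Submodule.disjoint_map (Submodule.subtype_injective _) hdec.disjoint)
  -- A nonzero form would give `2m = 2k`, which has only the two excluded solutions modulo the even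
  -- number `q - 1`.
  · by_contra h
    have hcard := Fintype.one_lt_card (α := Fq)
    have heven : Even (Fintype.card Fq - 1) := by
      obtain ⟨M, hM⟩ := hq
      exact ⟨M, by omega⟩
    exact (eq_or_eq_add_half_of_two_mul_eq (by omega) heven
      (two_mul_type_eq_weight hn h)).elim hm hm'
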